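/- Let $K$ be a field of characteristic $0$, let $n\ge 0$, and let $A_n=A_n(K)$ be the $n$-th Weyl algebra, i.e. the $K$-subalgebra of $\operatorname{End}_K(K[x_1,\dots,x_n])$ generated by the multiplications by $x_1,\dots,x_n$ and by the partial derivatives $\partial_1,\dots,\partial_n$. For $r\in\mathbb N$ let $B_r$ be the $K$-span of the monomials $x^\alpha\partial^\beta$, $\alpha,\beta\in\mathbb N^n$, with $|\alpha|+|\beta|\le r$. Let $M$ be a left $A_n$-module generated by $f_1,\dots,f_m$, and put $M_r=\sum_{i=1}^m B_rf_i$. Let $E$ be a free left $A_n$-module with basis $e_1,\dots,e_m$, let $\pi:E\to M$ be the $A_n$-linear map with $\pi(e_i)=f_i$, and let $N=\ker\pi$. Order the monomials $x^\alpha\partial^\beta e_i$ of $E$ (a $K$-basis of $E$) by comparing the tuples $(|\alpha|+|\beta|,\alpha_1,\dots,\alpha_n,\beta_1,\dots,\beta_n,i)$ lexicographically, and let $\mathrm{LM}(g)$ be the greatest monomial occurring with nonzero coefficient in $g\in E\setminus\{0\}$. Say that $x^\gamma\partial^\delta e_j$ is a multiple of $x^\alpha\partial^\beta e_i$ if $i=j$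 and $\alpha_k\le\gamma_k$, $\beta_k\le\delta_k$ for all $k$. A Gröbner basis of $N$ is a finite set $G$ of nonzero elements of $N$ such that for every nonzero $h\in N$ there is $g\in G$ for which $\mathrm{LM}(h)$ is a multiple of $\mathrm{LM}(g)$. A polynomial in $\mathbb Q[t]$ is numerical if its values at all sufficiently large natural numbers are integers. For $A\subseteq\mathbb N^{2n}$ let $V_A$ be the set of all $v\in\mathbb N^{2n}$ such that $a\le v$ (coordinatewise) for no $a\in A$. The Kolchin polynomial $\omega_A(t)$ of $A$ is the numerical polynomial such that, for all sufficiently large $s\in\mathbb N$, $\omega_A(s)$ is the number of $v\in V_A$ with coordinate sum at most $s$. Then there is a numerical polynomial $\chi(t)$ such that: (i) for all sufficiently large $r$, $M_r$ is finite-dimensional over $K$ and $\chi(r)=\dim_K M_r$; (ii) $\deg\chi\le 2n$, and $\chi(t)=\sum_{i=0}^{2n}a_i\binom{t+i}{i}$ with $a_0,\dots,a_{2n}\in\mathbb Z$; (iii) for every Gröbner basis $G$ of $N$, let $A_i$ be the set of exponents $(\alpha,\beta)\in\mathbb N^{2n}$ for which $x^\alpha\partial^\beta e_i$ is the leading monomial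 of an element of $G$, and let $V_i$ be the set of exponents $(\alpha,\beta)$ for which $x^\alpha\partial^\beta e_i$ is not a multiple of $\mathrm{LM}(g)$ for any $g\in G$ $(1\le i\le m)$. Then $V_i=V_{A_i}$ for every $i$, the Kolchin polynomials $\omega_{A_1},\dots,\omega_{A_m}$ exist, and $\chi(t)=\sum_{i=1}^m\omega_{A_i}(t)$; in particular, for all large $s$, $\omega_{A_i}(s)$ is the number of points of $V_i$ with coordinate sum at most $s$. -/

import Mathlib

noncomputable section

namespace Bernstein

/-! ### Numerical polynomials and Kolchin dimension polynomials -/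

/-- A polynomial with rational coefficients is numerical if it takes integer values at all
sufficiently large natural numbers. -/
def IsNumerical (f : Polynomial ℚ) : Prop :=
  ∃ r : ℕ, ∀ s : ℕ, r ≤ s → ∃ z : ℤ, f.eval (s : ℚ) = (z : ℚ)

/-- The polynomial `binom(t + i, i) = (t + i)(t + i - 1) ⋯ (t + 1) / i!`. -/
def binomPoly (i : ℕ) : Polynomial ℚ :=
  ((i.factorial : ℚ)⁻¹) •
    (descPochhammer ℚ i).comp (Polynomial.X + Polynomial.C (i : ℚ))

/-- `V_A`: the points that are not greater than or equal to any point of `A` in the product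
order. -/
def notAbove {ι : Type*} (A : Set (ι → ℕ)) : Set (ι → ℕ) :=
  {v | ∀ a ∈ A, ¬ a ≤ v}

/-- `A(r)`: the points of `A` whose coordinate sum is at most `r`. -/
def truncate {ι : Type*} [Fintype ι] (A : Set (ι → ℕ)) (r : ℕ) : Set (ι → ℕ) :=
  {a | a ∈ A ∧ ∑ i, a i ≤ r}

/-- `ω` is the Kolchin dimension polynomial of `A`: the numerical polynomial with
`ω(s) = Card V_A(s)` for all sufficiently large `s`. (Such an `ω` is unique, since a polynomial
is determined by its values at large integers.) -/
def IsKolchinPolynomial {ι : Type*} [Fintype ι] (A : Set (ι → ℕ)) (ω : Polynomial ℚ) : Prop :=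
  IsNumerical ω ∧
    ∃ s₀ : ℕ, ∀ s : ℕ, s₀ ≤ s → ω.eval (s : ℚ) = ((truncate (notAbove A) s).ncard : ℚ)

/-! ### The Weyl algebra and the Bernstein filtration -/

/-- The `n`-th Weyl algebra: the subalgebra of `End_K (K[x₁, …, xₙ])` generated by the
multiplications by the variables and by the partial derivatives. -/
def weylAlgebra (K : Type*) [Field K] (n : ℕ) :
    Subalgebra K (Module.End K (MvPolynomial (Fin n) K)) :=
  Algebra.adjoin K
    (Set.range (fun i : Fin n => LinearMap.mulLeft K (MvPolynomial.X i : MvPolynomial (Fin n) K)) ∪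
      Set.range (fun i : Fin n =>
        (MvPolynomial.pderiv i : Derivation K (MvPolynomial (Fin n) K) _).toLinearMap))

variable (K : Type*) [Field K] {n : ℕ}

/-- The operator `xᵢ`. -/
def opX (i : Fin n) : weylAlgebra K n :=
  ⟨LinearMap.mulLeft K (MvPolynomial.X i),
    Algebra.subset_adjoin (Or.inl ⟨i, rfl⟩)⟩

/-- The operator `∂ᵢ`. -/
def opD (i : Fin n) : weylAlgebra K n :=
  ⟨(MvPolynomial.pderiv i).toLinearMap,
    Algebra.subset_adjoin (Or.inr ⟨i, rfl⟩)⟩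

/-- Exponents `(α, β) ∈ ℕ²ⁿ`; the left summand indexes `α`, the right one `β`. -/
abbrev Exponent (n : ℕ) : Type := Fin n ⊕ Fin n → ℕ

/-- The monomial `x₁^α₁ ⋯ xₙ^αₙ ∂₁^β₁ ⋯ ∂ₙ^βₙ`. -/
def weylMonomial (u : Exponent n) : weylAlgebra K n :=
  (List.ofFn fun i : Fin n => opX K i ^ u (Sum.inl i)).prod *
    (List.ofFn fun i : Fin n => opD K i ^ u (Sum.inr i)).prod

/-- The total degree `|α| + |β|`. -/
def deg (u : Exponent n) : ℕ := ∑ i, u i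

/-- The Bernstein filtration: `B_r` is the `K`-span of the monomials of degree at most `r`. -/
def bernsteinFiltration (n r : ℕ) : Submodule K (weylAlgebra K n) :=
  Submodule.span K {D | ∃ u : Exponent n, deg u ≤ r ∧ D = weylMonomial K u}

/-- The induced filtration `M_r = ∑ᵢ B_r fᵢ`. -/
def moduleFiltration {m : ℕ} {M : Type*} [AddCommGroup M] [Module K M]
    [Module (weylAlgebra K n) M] [IsScalarTower K (weylAlgebra K n) M]
    (f : Fin m → M) (r : ℕ) : Submodule K M :=
  ⨆ i : Fin m, (bernsteinFiltration K n r).map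
    ((LinearMap.toSpanSingleton (weylAlgebra K n) M (f i)).restrictScalars K)

/-! ### Leading monomials and Gröbner bases in a free module -/

variable {K}

/-- `(i, u)` stands for the monomial `x^α ∂^β eᵢ` of a free module with basis `e₁, …, eₘ`,
where `u = (α, β)`. -/
abbrev MonomialIndex (n m : ℕ) : Type := Fin m × Exponent n

/-- The monomial order: `x^α ∂^β eᵢ` is compared through
`(|α| + |β|, α₁, …, αₙ, β₁, …, βₙ, i)`, lexicographically. -/
def orderKey {m : ℕ} (w : MonomialIndex n m) :
    ℕ ×ₗ (Lex (Fin n → ℕ)) ×ₗ (Lex (Fin n → ℕ)) ×ₗ (Fin m) :=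
  toLex (deg w.2, toLex (toLex (fun i => w.2 (Sum.inl i)),
    toLex (toLex (fun i => w.2 (Sum.inr i)), w.1)))

/-- `v` divides `w`: same basis vector, and exponents compare coordinatewise. -/
def Divides {m : ℕ} (v w : MonomialIndex n m) : Prop :=
  v.1 = w.1 ∧ v.2 ≤ w.2

section Module

variable {m : ℕ} {E : Type*} [AddCommGroup E] [Module (weylAlgebra K n) E]

/-- `w` is the leading monomial of `g`: in the representation of `g` as a `K`-linear combination
of monomials `x^α ∂^β eᵢ`, it is the greatest monomial with a nonzero coefficient. -/
def IsLeadingMonomial (e : Module.Basis (Fin m) (weylAlgebra K n) E)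
    (g : E) (w : MonomialIndex n m) : Prop :=
  ∃ c : MonomialIndex n m →₀ K,
    g = c.sum (fun v a => (a • weylMonomial K v.2) • e v.1) ∧
      c w ≠ 0 ∧ ∀ v, c v ≠ 0 → orderKey v ≤ orderKey w

/-- `G` is a Gröbner basis of the submodule `N`: a finite set of nonzero elements of `N` such that
the leading monomial of every nonzero element of `N` is divisible by the leading monomial of some
element of `G`. -/
def IsGroebnerBasis (e : Module.Basis (Fin m) (weylAlgebra K n) E)
    (N : Submodule (weylAlgebra K n) E) (G : Finset E) : Prop :=
  (∀ g ∈ G, g ∈ N ∧ g ≠ 0) ∧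
    ∀ h ∈ N, h ≠ 0 → ∃ g ∈ G, ∃ v w : MonomialIndex n m,
      IsLeadingMonomial e g v ∧ IsLeadingMonomial e h w ∧ Divides v w

/-- `Vᵢ`: the exponents of the monomials `x^α ∂^β eᵢ` that are not multiples of the leading
monomial of any element of `G`. -/
def nonMultiples (e : Module.Basis (Fin m) (weylAlgebra K n) E)
    (G : Finset E) (i : Fin m) : Set (Exponent n) :=
  {u | ¬ ∃ g ∈ G, ∃ v : MonomialIndex n m, IsLeadingMonomial e g v ∧ Divides v (i, u)}

/-- The exponents of those leading monomials of elements of `G` that involve `eᵢ`. -/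
def leadingExponents (e : Module.Basis (Fin m) (weylAlgebra K n) E)
    (G : Finset E) (i : Fin m) : Set (Exponent n) :=
  {u | ∃ g ∈ G, IsLeadingMonomial e g (i, u)}

end Module

end Bernstein

end

/-! Call a monomial of `E` normal if its exponent is not above the exponent of a leading monomial of
an element of `N` in the same component. The images of the normal monomials of degree at most `r`
form a basis of `M_r`. They are independent, since a relation lifts to an element of `N` whose
leading monomial is normal. They span, since a monomial that is not normal is congruent modulo `N`
to a combination of smaller ones; the order compares total degree first, so this rewriting stays
inside degree `r` (`linearIndepOn_normalIndices`, `monomialAt_mem_span_normalIndices`). The spanning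
argument needs the leading exponents of `N` to form upper sets. They do, because moving `∂ᵢ` past
`x^α` creates only a term of lower degree (`add_mem_submoduleLeadingExponents`). So `dim M_r` counts
points of bounded degree in `m` lower sets of `ℕ²ⁿ`. Such counts are eventually integral
combinations of `binom(s + i, i)`, by slicing along a coordinate and Dickson's lemma
(`eventuallyBinomial_ncard_truncate`). A Gröbner basis cuts out the same lower sets
(`notAbove_leadingExponents`); here the independence of the Weyl monomials in characteristic zero is
needed, to make leading monomials unique. -/

namespace Bernstein

/-! ### Counting points of lower sets -/

section Counting

/-- `f` agrees at all large `s` with an integral combination of the `binom(s + i, i)`,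
`i ≤ d`. -/
def EventuallyBinomial (d : ℕ) (f : ℕ → ℤ) : Prop :=
  ∃ (a : ℕ → ℤ) (s₀ : ℕ), ∀ s, s₀ ≤ s →
    f s = ∑ i ∈ Finset.range (d + 1), a i * ((s + i).choose i : ℤ)

theorem EventuallyBinomial.add {d : ℕ} {f g : ℕ → ℤ} (hf : EventuallyBinomial d f)
    (hg : EventuallyBinomial d g) : EventuallyBinomial d (fun s => f s + g s) := by
  obtain ⟨a, s, h⟩ := hf
  obtain ⟨b, t, k⟩ := hg
  refine ⟨fun i => a i + b i, max s t, fun r hr => ?_⟩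
  simp only [h r (le_trans (le_max_left _ _) hr), k r (le_trans (le_max_right _ _) hr), add_mul,
    Finset.sum_add_distrib]

theorem EventuallyBinomial.mono {d : ℕ} {f : ℕ → ℤ} (hf : EventuallyBinomial d f) :
    EventuallyBinomial (d + 1) f := by
  obtain ⟨a, s, h⟩ := hf
  refine ⟨fun i => if i < d + 1 then a i else 0, s, fun r hr => ?_⟩
  rw [h r hr, Finset.sum_range_succ _ (d + 1)]
  simp only [lt_irrefl, if_false, zero_mul, add_zero]
  exact Finset.sum_congr rfl fun i hi => by rw [if_pos (Finset.mem_range.1 hi)]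

theorem choose_add_succ (s i : ℕ) :
    ((s + 1 + (i + 1)).choose (i + 1) : ℤ) =
      ((s + (i + 1)).choose (i + 1) : ℤ) + ((s + 1 + i).choose i : ℤ) := by
  have h : (s + 1 + (i + 1)).choose (i + 1) =
      (s + 1 + i).choose i + (s + 1 + i).choose (i + 1) := Nat.choose_succ_succ _ _
  have e : s + (i + 1) = s + 1 + i := by ring
  rw [h, e]
  push_cast
  ring

theorem EventuallyBinomial.shift {d : ℕ} {f h : ℕ → ℤ} (hf : EventuallyBinomial d f)
    (hh : ∀ s, h (s + 1) = f s) : EventuallyBinomial d h := by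
  obtain ⟨a, s₀, H⟩ := hf
  -- Pascal's rule gives `C(s+i+1, i+1) = C(s+1+i+1, i+1) - C(s+1+i, i)`, so rewriting in terms of
  -- `s + 1` subtracts each coefficient from the one below it.
  refine ⟨fun i => a i - if i < d then a (i + 1) else 0, s₀ + 1, fun r hr => ?_⟩
  obtain ⟨s, rfl⟩ : ∃ s, r = s + 1 := ⟨r - 1, by omega⟩
  rw [hh, H s (by omega)]
  simp only [sub_mul, Finset.sum_sub_distrib]
  rw [Finset.sum_range_succ (fun i => (if i < d then a (i + 1) else 0) * _) d,
    Finset.sum_range_succ' _ d, Finset.sum_range_succ' _ d]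
  have h2 : ∑ i ∈ Finset.range d, (if i < d then a (i + 1) else 0) * ((s + 1 + i).choose i : ℤ) =
      ∑ i ∈ Finset.range d, a (i + 1) * ((s + 1 + i).choose i : ℤ) :=
    Finset.sum_congr rfl fun i hi => by rw [if_pos (Finset.mem_range.1 hi)]
  rw [h2]
  simp only [choose_add_succ, mul_add, Finset.sum_add_distrib]
  simp
  ring

/-- Discrete integration: `binom(s + i, i)` is the backward difference of `binom(s + i + 1, i + 1)`,
so the coefficients move up one place and a constant of summation `c` is fixed by the value at `s₀`.
-/
theorem EventuallyBinomial.of_sub {d : ℕ} {f g : ℕ → ℤ} (hg : EventuallyBinomial d g)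
    (hf : ∀ s, f (s + 1) = g (s + 1) + f s) : EventuallyBinomial (d + 1) f := by
  obtain ⟨a, s₀, H⟩ := hg
  let c : ℤ := f s₀ - ∑ i ∈ Finset.range (d + 1), a i * ((s₀ + (i + 1)).choose (i + 1) : ℤ)
  refine ⟨fun i => Nat.casesOn i c a, s₀, fun r hr => ?_⟩
  rw [Finset.sum_range_succ' _ (d + 1)]
  induction r, hr using Nat.le_induction with
  | base => simp [c]
  | succ r hr ih =>
    rw [hf, ih, H _ (by omega)]
    simp only [choose_add_succ, mul_add, Finset.sum_add_distrib]
    simp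
    ring

variable {ι : Type*} [Fintype ι]

theorem finite_truncate (V : Set (ι → ℕ)) (s : ℕ) : (truncate V s).Finite := by
  classical
  refine (Set.finite_Icc (0 : ι → ℕ) (fun _ : ι => s)).subset fun v hv =>
    ⟨fun _ => Nat.zero_le _, fun i => ?_⟩
  exact (Finset.single_le_sum (f := v) (fun _ _ => Nat.zero_le _) (Finset.mem_univ i)).trans hv.2

/-- Dickson's lemma: in a strictly descending chain choose `v k ∈ V k \ V (k + 1)`. Some `i < j` has
`v i ≤ v j`, and `v j ∈ V (i + 1)` forces `v i ∈ V (i + 1)`. -/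
theorem wellFounded_lowerSet : WellFoundedLT (LowerSet (ι → ℕ)) := by
  refine ⟨(RelEmbedding.wellFounded_iff_isEmpty).2 ⟨fun V => ?_⟩⟩
  have hV : StrictAnti V := strictAnti_nat_of_succ_lt fun k => V.map_rel_iff.2 (Nat.lt_succ_self k)
  have h : ∀ k, ∃ v, v ∈ V k ∧ v ∉ V (k + 1) := fun k =>
    Set.not_subset.1 (not_le_of_gt (hV (Nat.lt_succ_self k)))
  choose v hv hv' using h
  obtain ⟨i, j, hij, hle⟩ := wellQuasiOrdered_le v
  exact hv' i ((V (i + 1)).lower hle (hV.antitone (Nat.succ_le_of_lt hij) (hv j)))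

/-- Points with `v i ≠ 0` lose one unit in coordinate `i`, which lowers the degree bound from `s +
1` to `s`. -/
theorem ncard_truncate_succ [DecidableEq ι] (V : LowerSet (ι → ℕ)) (i : ι) (s : ℕ) :
    (truncate (V : Set (ι → ℕ)) (s + 1)).ncard =
      (truncate {v : ι → ℕ | v ∈ V ∧ v i = 0} (s + 1)).ncard +
        (truncate {v : ι → ℕ | v + Pi.single i 1 ∈ V} s).ncard := by
  have hinj : Function.Injective (fun v : ι → ℕ => v + Pi.single i 1) := add_left_injective _
  have key : truncate (V : Set (ι → ℕ)) (s + 1) =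
      truncate {v : ι → ℕ | v ∈ V ∧ v i = 0} (s + 1) ∪
        (fun v : ι → ℕ => v + Pi.single i 1) '' truncate {v : ι → ℕ | v + Pi.single i 1 ∈ V} s := by
    ext v
    constructor
    · rintro ⟨hv, hs⟩
      by_cases h0 : v i = 0
      · exact Or.inl ⟨⟨hv, h0⟩, hs⟩
      · have hle : Pi.single i 1 ≤ v := by
          intro j
          by_cases hj : j = i
          · subst hj; simp; omega
          · simp [hj]
        refine Or.inr ⟨v - Pi.single i 1, ⟨?_, ?_⟩, tsub_add_cancel_of_le hle⟩
        · change v - Pi.single i 1 + Pi.single i 1 ∈ V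
          rwa [tsub_add_cancel_of_le hle]
        · have h := congrArg (fun w : ι → ℕ => ∑ j, w j) (tsub_add_cancel_of_le hle)
          simp only [Pi.add_apply, Finset.sum_add_distrib, Finset.sum_pi_single', Finset.mem_univ,
            if_true] at h
          omega
    · rintro (⟨⟨hv, -⟩, hs⟩ | ⟨w, ⟨hw, hs⟩, rfl⟩)
      · exact ⟨hv, hs⟩
      · refine ⟨hw, ?_⟩
        simp only [Pi.add_apply, Finset.sum_add_distrib, Finset.sum_pi_single', Finset.mem_univ, if_true]
        omega
  have hdisj : Disjoint (truncate {v : ι → ℕ | v ∈ V ∧ v i = 0} (s + 1))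
      ((fun v : ι → ℕ => v + Pi.single i 1) ''
        truncate {v : ι → ℕ | v + Pi.single i 1 ∈ V} s) := by
    rw [Set.disjoint_left]
    rintro _ ⟨⟨-, h0⟩, -⟩ ⟨w, -, rfl⟩
    simp at h0
  rw [key, Set.ncard_union_eq hdisj (finite_truncate _ _) ((finite_truncate _ _).image _),
    Set.ncard_image_of_injective _ hinj]

/-- Double induction: on the set `S` of coordinates allowed to be nonzero, which bounds the degree,
and for fixed `S` on `V` in the well-founded order of lower sets. -/
theorem eventuallyBinomial_ncard_truncate [DecidableEq ι] (S : Finset ι) : ∀ V : LowerSet (ι → ℕ),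
    (∀ v ∈ V, ∀ i ∉ S, v i = 0) →
      EventuallyBinomial S.card (fun s => ((truncate (V : Set (ι → ℕ)) s).ncard : ℤ)) := by
  induction S using Finset.induction_on with
  | empty =>
    intro V hV
    refine ⟨fun _ => ((V : Set (ι → ℕ)).ncard : ℤ), 0, fun s _ => ?_⟩
    have : truncate (V : Set (ι → ℕ)) s = V := by
      ext v
      refine ⟨fun h => h.1, fun h => ⟨h, ?_⟩⟩
      simp [hV v h]
    simp [this]
  | insert i S hi ih =>
    intro V
    refine (wellFounded_lowerSet (ι := ι)).wf.induction (C := fun V : LowerSet (ι → ℕ) =>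
      (∀ v ∈ V, ∀ j ∉ insert i S, v j = 0) → EventuallyBinomial (insert i S).card
        (fun s => ((truncate (V : Set (ι → ℕ)) s).ncard : ℤ))) V fun V IH hV => ?_
    rw [Finset.card_insert_of_notMem hi]
    let V₀ : LowerSet (ι → ℕ) := ⟨{v : ι → ℕ | v ∈ V ∧ v i = 0}, fun v w hwv hv =>
      ⟨V.lower hwv hv.1, Nat.le_zero.1 (hv.2 ▸ hwv i)⟩⟩
    let V' : LowerSet (ι → ℕ) := ⟨{v : ι → ℕ | v + Pi.single i 1 ∈ V}, fun v w hwv hv =>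
      V.lower (by gcongr) hv⟩
    have h₀ := ih V₀ (fun v hv j hj => by
      by_cases hji : j = i
      · exact hji ▸ hv.2
      · exact hV v hv.1 j (by simp [hj, hji]))
    have hsucc : ∀ s, ((truncate (V : Set (ι → ℕ)) (s + 1)).ncard : ℤ) =
        ((truncate (V₀ : Set (ι → ℕ)) (s + 1)).ncard : ℤ) +
          ((truncate (V' : Set (ι → ℕ)) s).ncard : ℤ) := fun s => by
      exact_mod_cast ncard_truncate_succ V i s
    have hle : V' ≤ V := fun v hv => V.lower (self_le_add_right v _) hv
    -- If `V' = V`, the count for `V` has as difference the count for the slice `V₀`, which lives on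
    -- `S`; sum it. Otherwise `V'` is strictly smaller, and the count for `V` is that for `V₀` plus
    -- a shift of that for `V'`.
    rcases hle.eq_or_lt with heq | hlt
    · rw [heq] at hsucc
      exact h₀.of_sub hsucc
    · have h' := IH V' hlt (fun v hv j hj => hV v (hle hv) j hj)
      rw [Finset.card_insert_of_notMem hi] at h'
      have h'' : EventuallyBinomial (S.card + 1) (fun s =>
          ((truncate (V : Set (ι → ℕ)) s).ncard : ℤ) -
            ((truncate (V₀ : Set (ι → ℕ)) s).ncard : ℤ)) :=
        h'.shift fun s => by rw [hsucc]; ring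
      simpa using h₀.mono.add h''

theorem eval_binomPoly (i s : ℕ) : (binomPoly i).eval (s : ℚ) = ((s + i).choose i : ℚ) := by
  have h : ((s : ℚ) + (i : ℚ)) = ((s + i : ℕ) : ℚ) := by push_cast; rfl
  rw [binomPoly, Polynomial.eval_smul, Polynomial.eval_comp, Polynomial.eval_add,
    Polynomial.eval_X, Polynomial.eval_C, h, descPochhammer_eval_eq_descFactorial,
    Nat.descFactorial_eq_factorial_mul_choose, Nat.cast_mul, smul_eq_mul,
    inv_mul_cancel_left₀ (by exact_mod_cast i.factorial_ne_zero)]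

theorem natDegree_binomPoly_le (i : ℕ) : (binomPoly i).natDegree ≤ i := by
  refine (Polynomial.natDegree_smul_le _ _).trans (Polynomial.natDegree_comp_le.trans ?_)
  rw [descPochhammer_natDegree, Polynomial.natDegree_X_add_C, mul_one]

theorem isNumerical_sum_binomPoly (d : ℕ) (a : ℕ → ℤ) :
    IsNumerical (∑ i ∈ Finset.range d, Polynomial.C (a i : ℚ) * binomPoly i) := by
  refine ⟨0, fun s _ => ⟨∑ i ∈ Finset.range d, a i * ((s + i).choose i : ℤ), ?_⟩⟩
  simp [Polynomial.eval_finsetSum, eval_binomPoly]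

theorem exists_isKolchinPolynomial (A : Set (ι → ℕ)) : ∃ a : ℕ → ℤ,
    IsKolchinPolynomial A
      (∑ i ∈ Finset.range (Fintype.card ι + 1), Polynomial.C (a i : ℚ) * binomPoly i) := by
  classical
  let V : LowerSet (ι → ℕ) := ⟨notAbove A, fun v w hwv hv a ha h => hv a ha (h.trans hwv)⟩
  obtain ⟨a, s₀, h⟩ := eventuallyBinomial_ncard_truncate Finset.univ V (by simp)
  refine ⟨a, isNumerical_sum_binomPoly _ a, s₀, fun s hs => ?_⟩
  have h' := congrArg (Int.cast : ℤ → ℚ) (h s hs)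
  simp only [Int.cast_natCast] at h'
  refine Eq.trans ?_ h'.symm
  simp [Polynomial.eval_finsetSum, eval_binomPoly]

end Counting

/-! ### Products of powers of commuting elements -/

section CommutingPowers

theorem mul_list_prod_pow {R ι : Type*} [Monoid R] [DecidableEq ι] (x : ι → R)
    (hx : ∀ i j, Commute (x i) (x j)) (u : ι → ℕ) (i : ι) (l : List ι) (hl : l.Nodup)
    (hi : i ∈ l) :
    x i * (l.map fun j => x j ^ u j).prod =
      (l.map fun j => x j ^ (u + Pi.single i 1 : ι → ℕ) j).prod := by
  induction l with
  | nil => simp at hi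
  | cons k l ih =>
    simp only [List.map_cons, List.prod_cons]
    rcases List.mem_cons.1 hi with rfl | hi'
    · have hnot := (List.nodup_cons.1 hl).1
      rw [← mul_assoc, ← pow_succ', Pi.add_apply, Pi.single_eq_same]
      congr 2
      refine List.map_congr_left fun j hj => ?_
      have : j ≠ i := fun h => hnot (h ▸ hj)
      simp [this]
    · have hk : k ≠ i := fun h => (List.nodup_cons.1 hl).1 (h ▸ hi')
      rw [← mul_assoc, ((hx i k).pow_right _).eq, mul_assoc, ih (List.nodup_cons.1 hl).2 hi']
      simp [hk]

theorem mul_prod_ofFn_pow {R : Type*} [Monoid R] {n : ℕ} (x : Fin n → R)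
    (hx : ∀ i j, Commute (x i) (x j)) (u : Fin n → ℕ) (i : Fin n) :
    x i * (List.ofFn fun j => x j ^ u j).prod =
      (List.ofFn fun j => x j ^ (u + Pi.single i 1 : Fin n → ℕ) j).prod := by
  simpa only [List.ofFn_eq_map] using
    mul_list_prod_pow x hx u i _ (List.nodup_finRange n) (List.mem_finRange i)

theorem induction_add_single {n : ℕ} {P : (Fin n → ℕ) → Prop} (h0 : P 0)
    (h : ∀ u i, P u → P (u + Pi.single i 1)) (u : Fin n → ℕ) : P u := by
  obtain ⟨k, hk⟩ : ∃ k, ∑ i, u i = k := ⟨_, rfl⟩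
  induction k generalizing u with
  | zero =>
    have : u = 0 := by
      ext i
      exact (Finset.sum_eq_zero_iff.1 hk) i (Finset.mem_univ i)
    exact this ▸ h0
  | succ k ih =>
    obtain ⟨i, hi⟩ : ∃ i, u i ≠ 0 := by
      by_contra! hcon
      simp [hcon] at hk
    have hle : Pi.single i 1 ≤ u := by
      intro j
      by_cases hj : j = i
      · subst hj; simp; omega
      · simp [hj]
    have hu := tsub_add_cancel_of_le hle
    rw [← hu]
    refine h _ _ (ih _ ?_)
    have h' := congrArg (fun w : Fin n → ℕ => ∑ j, w j) hu
    simp only [Pi.add_apply, Finset.sum_add_distrib, Finset.sum_pi_single',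
      Finset.mem_univ, if_true] at h'
    omega

end CommutingPowers

/-! ### Monomials of the Weyl algebra -/

section WeylAlgebra

variable (K : Type*) [Field K] {n : ℕ}

/-- The monomial `x^α` of the Weyl algebra. -/
noncomputable def xMonomial (u : Fin n → ℕ) : weylAlgebra K n := (List.ofFn fun i => opX K i ^ u i).prod

/-- The monomial `∂^β` of the Weyl algebra. -/
noncomputable def dMonomial (u : Fin n → ℕ) : weylAlgebra K n := (List.ofFn fun i => opD K i ^ u i).prod

theorem weylMonomial_eq (u : Exponent n) :
    weylMonomial K u = xMonomial K (u ∘ Sum.inl) * dMonomial K (u ∘ Sum.inr) := rfl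

theorem weyl_ext {a b : weylAlgebra K n}
    (h : ∀ p, (a : Module.End K (MvPolynomial (Fin n) K)) p =
      (b : Module.End K (MvPolynomial (Fin n) K)) p) : a = b :=
  Subtype.ext (LinearMap.ext h)

theorem opX_apply (i : Fin n) (p : MvPolynomial (Fin n) K) :
    (opX K i : Module.End K (MvPolynomial (Fin n) K)) p = MvPolynomial.X i * p := rfl

theorem opD_apply (i : Fin n) (p : MvPolynomial (Fin n) K) :
    (opD K i : Module.End K (MvPolynomial (Fin n) K)) p = MvPolynomial.pderiv i p := rfl

theorem mul_apply (a b : weylAlgebra K n) (p : MvPolynomial (Fin n) K) :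
    ((a * b : weylAlgebra K n) : Module.End K (MvPolynomial (Fin n) K)) p =
      (a : Module.End K (MvPolynomial (Fin n) K))
        ((b : Module.End K (MvPolynomial (Fin n) K)) p) := rfl

theorem commute_opX (i j : Fin n) : Commute (opX K i) (opX K j) := by
  refine weyl_ext K fun p => ?_
  simp only [mul_apply, opX_apply]
  ring

theorem commute_opD (i j : Fin n) : Commute (opD K i) (opD K j) := by
  refine weyl_ext K fun p => ?_
  simp only [mul_apply, opD_apply]
  induction p using MvPolynomial.induction_on' with
  | monomial u a =>
    simp only [MvPolynomial.pderiv_monomial]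
    by_cases h : i = j
    · rw [h]
    · rw [tsub_right_comm]
      simp [h, Ne.symm h, mul_right_comm]
  | add p q hp hq => simp only [map_add, hp, hq]

theorem opX_mul_xMonomial (u : Fin n → ℕ) (i : Fin n) :
    opX K i * xMonomial K u = xMonomial K (u + Pi.single i 1) :=
  mul_prod_ofFn_pow _ (commute_opX K) u i

theorem opD_mul_dMonomial (u : Fin n → ℕ) (i : Fin n) :
    opD K i * dMonomial K u = dMonomial K (u + Pi.single i 1) :=
  mul_prod_ofFn_pow _ (commute_opD K) u i

theorem xMonomial_zero : xMonomial K (0 : Fin n → ℕ) = 1 := by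
  simp [xMonomial]

theorem dMonomial_zero : dMonomial K (0 : Fin n → ℕ) = 1 := by
  simp [dMonomial]

theorem equivFunOnFinite_symm_add_single (u : Fin n → ℕ) (i : Fin n) :
    Finsupp.equivFunOnFinite.symm (u + Pi.single i 1) =
      Finsupp.equivFunOnFinite.symm u + Finsupp.single i 1 := by
  ext j
  simp [Finsupp.single_apply, Pi.single_apply, eq_comm]

theorem xMonomial_apply (u : Fin n → ℕ) (p : MvPolynomial (Fin n) K) :
    (xMonomial K u : Module.End K (MvPolynomial (Fin n) K)) p =
      MvPolynomial.monomial (Finsupp.equivFunOnFinite.symm u) 1 * p := by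
  induction u using induction_add_single with
  | h0 =>
    have : (Finsupp.equivFunOnFinite.symm (0 : Fin n → ℕ)) = 0 := by ext; simp
    rw [xMonomial_zero, this]
    simp
  | h u i ih =>
    rw [← opX_mul_xMonomial, mul_apply, opX_apply, ih, equivFunOnFinite_symm_add_single,
      ← mul_assoc, MvPolynomial.X, MvPolynomial.monomial_mul, add_comm, mul_one]

/-- The truncated subtraction is harmless: if some `u j > v j`, the falling factorial vanishes. -/
theorem dMonomial_apply (u : Fin n → ℕ) (v : Fin n →₀ ℕ) (a : K) :
    (dMonomial K u : Module.End K (MvPolynomial (Fin n) K)) (MvPolynomial.monomial v a) =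
      MvPolynomial.monomial (v - Finsupp.equivFunOnFinite.symm u)
        (a * ∏ j, ((v j).descFactorial (u j) : K)) := by
  induction u using induction_add_single with
  | h0 =>
    have : (Finsupp.equivFunOnFinite.symm (0 : Fin n → ℕ)) = 0 := by ext; simp
    rw [dMonomial_zero, this]
    simp
  | h u i ih =>
    rw [← opD_mul_dMonomial, mul_apply, opD_apply, ih, MvPolynomial.pderiv_monomial,
      equivFunOnFinite_symm_add_single, tsub_tsub, mul_assoc]
    congr 2
    refine Eq.trans ?_ (Finset.prod_erase_mul _ _ (Finset.mem_univ i))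
    rw [← Finset.prod_erase_mul _ _ (Finset.mem_univ i), mul_assoc]
    congr 1
    · refine Finset.prod_congr rfl fun j hj => ?_
      have : j ≠ i := (Finset.mem_erase.1 hj).1
      simp [this]
    · simp [Nat.descFactorial_succ, mul_comm]

/-- The Leibniz rule; when `u i = 0` the coefficient removes the truncated term. -/
theorem opD_mul_xMonomial (u : Fin n → ℕ) (i : Fin n) :
    opD K i * xMonomial K u = xMonomial K u * opD K i +
      (u i : K) • xMonomial K (u - Pi.single i 1) := by
  refine weyl_ext K fun p => ?_
  have he : Finsupp.equivFunOnFinite.symm (u - Pi.single i 1) =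
      Finsupp.equivFunOnFinite.symm u - Finsupp.single i 1 := by
    ext j
    simp [Finsupp.single_apply, Pi.single_apply, eq_comm]
  have hs : ((xMonomial K u * opD K i + (u i : K) • xMonomial K (u - Pi.single i 1) :
      weylAlgebra K n) : Module.End K (MvPolynomial (Fin n) K)) p =
      (xMonomial K u : Module.End K (MvPolynomial (Fin n) K)) (MvPolynomial.pderiv i p) +
        (u i : K) • (xMonomial K (u - Pi.single i 1) :
          Module.End K (MvPolynomial (Fin n) K)) p := rfl
  rw [hs, mul_apply, opD_apply, xMonomial_apply, xMonomial_apply, xMonomial_apply,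
    MvPolynomial.pderiv_mul, MvPolynomial.pderiv_monomial, he, add_comm, ← smul_mul_assoc,
    MvPolynomial.smul_monomial]
  simp

theorem opX_mul_weylMonomial (u : Exponent n) (i : Fin n) :
    opX K i * weylMonomial K u = weylMonomial K (u + Pi.single (Sum.inl i) 1) := by
  rw [weylMonomial_eq, ← mul_assoc, opX_mul_xMonomial, weylMonomial_eq]
  have hl : (u + Pi.single (Sum.inl i) 1 : Exponent n) ∘ Sum.inl =
      u ∘ Sum.inl + Pi.single i 1 := by
    ext j; simp [Pi.single_apply]
  have hr : (u + Pi.single (Sum.inl i) 1 : Exponent n) ∘ Sum.inr = u ∘ Sum.inr := by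
    ext j; simp
  rw [hl, hr]

theorem opD_mul_weylMonomial (u : Exponent n) (i : Fin n) :
    opD K i * weylMonomial K u = weylMonomial K (u + Pi.single (Sum.inr i) 1) +
      (u (Sum.inl i) : K) • weylMonomial K (u - Pi.single (Sum.inl i) 1) := by
  rw [weylMonomial_eq, ← mul_assoc, opD_mul_xMonomial, add_mul, mul_assoc, opD_mul_dMonomial,
    weylMonomial_eq, weylMonomial_eq, smul_mul_assoc]
  have hl : (u + Pi.single (Sum.inr i) 1 : Exponent n) ∘ Sum.inl = u ∘ Sum.inl := by
    ext j; simp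
  have hr : (u + Pi.single (Sum.inr i) 1 : Exponent n) ∘ Sum.inr =
      u ∘ Sum.inr + Pi.single i 1 := by
    ext j; simp [Pi.single_apply]
  have hl' : (u - Pi.single (Sum.inl i) 1 : Exponent n) ∘ Sum.inl =
      u ∘ Sum.inl - Pi.single i 1 := by
    ext j; simp [Pi.single_apply]
  have hr' : (u - Pi.single (Sum.inl i) 1 : Exponent n) ∘ Sum.inr = u ∘ Sum.inr := by
    ext j; simp
  rw [hl, hr, hl', hr']
  rfl

/-- Evaluate a relation at `x^b`, where `b` is a `∂`-exponent of least total degree in its support.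
Every other `∂`-exponent there exceeds `b` in some coordinate and kills `x^b`. The remaining terms
give `b!` times distinct monomials `x^α`, and `b! ≠ 0` in characteristic zero. -/
theorem linearIndependent_weylMonomial [CharZero K] :
    LinearIndependent K (weylMonomial K : Exponent n → weylAlgebra K n) := by
  refine LinearIndependent.of_comp (weylAlgebra K n).val.toLinearMap ?_
  rw [linearIndependent_iff]
  intro c hc
  by_contra hne
  obtain ⟨w, hw, hmin⟩ := Finset.exists_min_image c.support
    (fun v => ∑ j, v (Sum.inr j)) (Finsupp.support_nonempty_iff.2 hne)
  let b : Fin n →₀ ℕ := Finsupp.equivFunOnFinite.symm (w ∘ Sum.inr)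
  have hterm : ∀ v ∈ c.support, (weylMonomial K v : Module.End K (MvPolynomial (Fin n) K))
      (MvPolynomial.monomial b 1) = if v ∘ Sum.inr = w ∘ Sum.inr then
        MvPolynomial.monomial (Finsupp.equivFunOnFinite.symm (v ∘ Sum.inl))
          (∏ j, ((w (Sum.inr j)).factorial : K)) else 0 := by
    intro v hv
    rw [weylMonomial_eq, mul_apply, dMonomial_apply, xMonomial_apply, MvPolynomial.monomial_mul,
      one_mul, one_mul]
    split_ifs with h
    · rw [h]
      simp [b, Nat.descFactorial_self]
    -- Otherwise `v ≤ w` on the `∂`-part, and minimality of the degree of `w` would force equality.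
    · obtain ⟨j, hj⟩ : ∃ j, w (Sum.inr j) < v (Sum.inr j) := by
        by_contra! hle
        refine h (funext fun j => ?_)
        exact (Finset.sum_eq_sum_iff_of_le (fun j _ => hle j)).1
          (le_antisymm (Finset.sum_le_sum fun j _ => hle j) (hmin v hv)) j (Finset.mem_univ j)
      rw [Finset.prod_eq_zero (Finset.mem_univ j), map_zero]
      simpa [b, Nat.descFactorial_eq_zero_iff_lt] using hj
  have happ : c.sum (fun v a => a • (weylMonomial K v : Module.End K (MvPolynomial (Fin n) K))
      (MvPolynomial.monomial b 1)) = 0 := by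
    have h := congrArg (LinearMap.applyₗ (R := K) (MvPolynomial.monomial b (1 : K))) hc
    rw [Finsupp.linearCombination_apply, Finsupp.sum, map_sum, map_zero] at h
    simp only [map_smul] at h
    exact h
  have hcoeff := congrArg (MvPolynomial.coeff (Finsupp.equivFunOnFinite.symm (w ∘ Sum.inl))) happ
  rw [Finsupp.sum, MvPolynomial.coeff_sum, Finset.sum_eq_single w] at hcoeff
  · rw [hterm w hw, if_pos rfl, MvPolynomial.coeff_smul, MvPolynomial.coeff_monomial, if_pos rfl,
      MvPolynomial.coeff_zero, smul_eq_mul] at hcoeff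
    refine (mul_ne_zero (Finsupp.mem_support_iff.1 hw) (Finset.prod_ne_zero_iff.2 fun j _ => ?_))
      hcoeff
    exact_mod_cast Nat.factorial_ne_zero _
  · intro v hv hvw
    rw [hterm v hv]
    split_ifs with h
    · rw [MvPolynomial.coeff_smul, MvPolynomial.coeff_monomial, if_neg, smul_zero]
      intro hl
      refine hvw (funext fun j => ?_)
      rcases j with j | j
      · exact congrFun (Finsupp.equivFunOnFinite.symm.injective hl) j
      · exact congrFun h j
    · simp
  · exact fun h => (h hw).elim

end WeylAlgebra

/-! ### The monomial order -/

section Order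

variable {n m : ℕ}

/-- The product of the monomial `w` with the variables of exponent `u`. -/
def shiftIndex (w : MonomialIndex n m) (u : Exponent n) : MonomialIndex n m := (w.1, w.2 + u)

theorem orderKey_injective : Function.Injective (orderKey : MonomialIndex n m → _) := by
  intro v w h
  have h1 := congrArg (fun k => (ofLex (ofLex k).2).1) h
  have h2 := congrArg (fun k => (ofLex (ofLex (ofLex k).2).2).1) h
  have h3 := congrArg (fun k => (ofLex (ofLex (ofLex k).2).2).2) h
  refine Prod.ext h3 (funext fun j => ?_)
  rcases j with j | j
  · exact congrFun h1 j
  · exact congrFun h2 j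

theorem deg_le_of_orderKey_le {v w : MonomialIndex n m} (h : orderKey v ≤ orderKey w) :
    deg v.2 ≤ deg w.2 := by
  rcases Prod.Lex.toLex_le_toLex.1 h with h | h
  · exact h.le
  · exact h.1.le

theorem orderKey_lt_of_deg_lt {v w : MonomialIndex n m} (h : deg v.2 < deg w.2) :
    orderKey v < orderKey w :=
  Prod.Lex.toLex_lt_toLex.2 (Or.inl h)

theorem deg_add (u v : Exponent n) : deg (u + v) = deg u + deg v :=
  Finset.sum_add_distrib

theorem deg_single (k : Fin n ⊕ Fin n) : deg (Pi.single k 1 : Exponent n) = 1 := by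
  simp only [deg, Finset.sum_pi_single', Finset.mem_univ, if_true]

theorem deg_mono {u v : Exponent n} (h : u ≤ v) : deg u ≤ deg v :=
  Finset.sum_le_sum fun i _ => h i

/-- Translation adds the same amount to both keys in every exponent entry and fixes the index of the
basis vector, so each lexicographic comparison is unchanged. -/
theorem orderKey_shift_lt {v w : MonomialIndex n m} (h : orderKey v < orderKey w)
    (u : Exponent n) : orderKey (shiftIndex v u) < orderKey (shiftIndex w u) := by
  have hl : ∀ z : MonomialIndex n m, toLex (fun i => (shiftIndex z u).2 (Sum.inl i)) =
      toLex (fun i => z.2 (Sum.inl i)) + toLex (fun i => u (Sum.inl i)) := fun _ => rfl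
  have hr : ∀ z : MonomialIndex n m, toLex (fun i => (shiftIndex z u).2 (Sum.inr i)) =
      toLex (fun i => z.2 (Sum.inr i)) + toLex (fun i => u (Sum.inr i)) := fun _ => rfl
  have hd : ∀ z : MonomialIndex n m, deg (shiftIndex z u).2 = deg z.2 + deg u :=
    fun z => deg_add _ _
  have hf : ∀ z : MonomialIndex n m, (shiftIndex z u).1 = z.1 := fun _ => rfl
  simp only [orderKey, Prod.Lex.toLex_lt_toLex, hl, hr, hd, hf, add_lt_add_iff_right,
    add_left_inj] at h ⊢
  exact h

end Order

/-! ### Leading monomials -/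

section NormalIndices

variable {K : Type*} [Field K] {n m : ℕ} {E : Type*} [AddCommGroup E]
  [Module (weylAlgebra K n) E]

theorem nonMultiples_eq_notAbove (e : Module.Basis (Fin m) (weylAlgebra K n) E) (G : Finset E)
    (i : Fin m) : nonMultiples e G i = notAbove (leadingExponents e G i) := by
  ext u
  constructor
  · rintro hu a ⟨g, hg, hlead⟩ hle
    exact hu ⟨g, hg, _, hlead, rfl, hle⟩
  · rintro hu ⟨g, hg, ⟨j, v⟩, hlead, rfl, hle⟩
    exact hu v ⟨g, hg, hlead⟩ hle

/-- The exponents of the leading monomials of elements of `N` that involve `eᵢ`. -/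
def submoduleLeadingExponents (e : Module.Basis (Fin m) (weylAlgebra K n) E)
    (N : Submodule (weylAlgebra K n) E) (i : Fin m) : Set (Exponent n) :=
  {u | ∃ g ∈ N, IsLeadingMonomial e g (i, u)}

/-- The monomials of degree at most `r` that are not multiples of leading monomials of `N`. -/
def normalIndices (e : Module.Basis (Fin m) (weylAlgebra K n) E)
    (N : Submodule (weylAlgebra K n) E) (r : ℕ) : Set (MonomialIndex n m) :=
  {w | w.2 ∈ truncate (notAbove (submoduleLeadingExponents e N w.1)) r}

theorem finite_normalIndices (e : Module.Basis (Fin m) (weylAlgebra K n) E)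
    (N : Submodule (weylAlgebra K n) E) (r : ℕ) : (normalIndices e N r).Finite := by
  refine (Set.finite_univ.prod (finite_truncate (Set.univ : Set (Exponent n)) r)).subset ?_
  exact fun w hw => ⟨Set.mem_univ _, Set.mem_univ _, hw.2⟩

theorem ncard_normalIndices (e : Module.Basis (Fin m) (weylAlgebra K n) E)
    (N : Submodule (weylAlgebra K n) E) (r : ℕ) : (normalIndices e N r).ncard =
      ∑ i, (truncate (notAbove (submoduleLeadingExponents e N i)) r).ncard := by
  have : ∀ i, Finite (truncate (notAbove (submoduleLeadingExponents e N i)) r) :=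
    fun i => finite_truncate _ r
  let φ : normalIndices e N r ≃
      (Σ i, truncate (notAbove (submoduleLeadingExponents e N i)) r) :=
    { toFun := fun w => ⟨w.1.1, w.1.2, w.2⟩
      invFun := fun x => ⟨(x.1, x.2.1), x.2.2⟩
      left_inv := fun _ => rfl
      right_inv := fun _ => rfl }
  rw [← Nat.card_coe_set_eq, Nat.card_congr φ, Nat.card_sigma]
  exact Finset.sum_congr rfl fun i _ => Nat.card_coe_set_eq _

end NormalIndices

/-! ### Leading monomials under multiplication by `xᵢ` and `∂ᵢ` -/

section LeadingMonomial

variable {K : Type*} [Field K] {n m : ℕ} {E : Type*} [AddCommGroup E]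
  [Module (weylAlgebra K n) E] [Module K E] [IsScalarTower K (weylAlgebra K n) E]

/-- The element `x^α ∂^β eᵢ`. -/
noncomputable def monomialAt (e : Fin m → E) (w : MonomialIndex n m) : E :=
  weylMonomial K w.2 • e w.1

/-- The span of the monomials below `w`. -/
noncomputable def lowerSpan (e : Fin m → E) (w : MonomialIndex n m) : Submodule K E :=
  Submodule.span K (monomialAt (K := K) e '' {v | orderKey v < orderKey w})

theorem sum_smul_smul (e : Fin m → E) (c : MonomialIndex n m →₀ K) :
    c.sum (fun v a => (a • weylMonomial K v.2) • e v.1) =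
      Finsupp.linearCombination K (monomialAt (K := K) e) c := by
  simp only [Finsupp.linearCombination_apply, monomialAt, smul_assoc]

/-- Trades coefficient functions for membership in a span, which is easier to carry through left
multiplication and through `π`. -/
theorem isLeadingMonomial_iff (e : Module.Basis (Fin m) (weylAlgebra K n) E) (g : E)
    (w : MonomialIndex n m) : IsLeadingMonomial e g w ↔
      ∃ a : K, a ≠ 0 ∧ ∃ l ∈ lowerSpan (K := K) e w, g = a • monomialAt (K := K) e w + l := by
  classical
  constructor
  · rintro ⟨c, hg, hw, hc⟩
    refine ⟨c w, hw, Finsupp.linearCombination K (monomialAt (K := K) e) (c.erase w), ?_, ?_⟩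
    · refine (Finsupp.mem_span_image_iff_linearCombination K).2 ⟨_, ?_, rfl⟩
      intro v hv
      rw [Finset.mem_coe, Finsupp.support_erase, Finset.mem_erase, Finsupp.mem_support_iff] at hv
      exact lt_of_le_of_ne (hc v hv.2) fun h => hv.1 (orderKey_injective h)
    · rw [hg, sum_smul_smul]
      conv_lhs => rw [← Finsupp.single_add_erase w c]
      rw [map_add, Finsupp.linearCombination_single]
  · rintro ⟨a, ha, l, hl, rfl⟩
    obtain ⟨d, hd, rfl⟩ := (Finsupp.mem_span_image_iff_linearCombination K).1 hl
    have hd' : ∀ v, d v ≠ 0 → orderKey v < orderKey w := fun v hv =>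
      hd (Finsupp.mem_support_iff.2 hv)
    have hdw : d w = 0 := by
      by_contra h
      exact lt_irrefl _ (hd' w h)
    refine ⟨Finsupp.single w a + d, ?_, ?_, ?_⟩
    · rw [sum_smul_smul, map_add, Finsupp.linearCombination_single]
    · simpa [hdw] using ha
    · intro v hv
      by_cases h : v = w
      · rw [h]
      · refine (hd' v ?_).le
        simpa [Finsupp.single_apply, Ne.symm h] using hv

theorem linearIndependent_monomialAt [CharZero K]
    (e : Module.Basis (Fin m) (weylAlgebra K n) E) :
    LinearIndependent K (monomialAt (K := K) (n := n) e) :=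
  (linearIndependent_smul (linearIndependent_weylMonomial K) e.linearIndependent).comp Prod.swap
    Prod.swap_injective

theorem IsLeadingMonomial.ne_zero [CharZero K] {e : Module.Basis (Fin m) (weylAlgebra K n) E}
    {g : E} {w : MonomialIndex n m} (h : IsLeadingMonomial e g w) : g ≠ 0 := by
  rintro rfl
  obtain ⟨c, hg, hw, -⟩ := h
  rw [sum_smul_smul] at hg
  have := linearIndependent_iff.1 (linearIndependent_monomialAt e) c hg.symm
  simp [this] at hw

/-- The definition only asks for some representation; independence of the monomials makes that
representation unique. -/
theorem IsLeadingMonomial.unique [CharZero K] {e : Module.Basis (Fin m) (weylAlgebra K n) E}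
    {g : E} {v w : MonomialIndex n m} (hv : IsLeadingMonomial e g v)
    (hw : IsLeadingMonomial e g w) : v = w := by
  obtain ⟨c, hc, hcv, hcmax⟩ := hv
  obtain ⟨d, hd, hdw, hdmax⟩ := hw
  rw [sum_smul_smul] at hc hd
  have : c = d := linearIndependent_monomialAt e (hc.symm.trans hd)
  subst this
  exact orderKey_injective (le_antisymm (hdmax v hcv) (hcmax w hdw))

theorem exists_isLeadingMonomial (e : Module.Basis (Fin m) (weylAlgebra K n) E)
    {c : MonomialIndex n m →₀ K} (hc : c ≠ 0) : ∃ w, c w ≠ 0 ∧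
      IsLeadingMonomial e (Finsupp.linearCombination K (monomialAt (K := K) e) c) w := by
  obtain ⟨w, hw, hmax⟩ := Finset.exists_max_image c.support orderKey
    (Finsupp.support_nonempty_iff.2 hc)
  rw [Finsupp.mem_support_iff] at hw
  exact ⟨w, hw, c, (sum_smul_smul _ _).symm, hw,
    fun v hv => hmax v (Finsupp.mem_support_iff.2 hv)⟩

/-- The generator of the Weyl algebra with a given index. -/
noncomputable def weylGenerator : Fin n ⊕ Fin n → weylAlgebra K n
  | Sum.inl i => opX K i
  | Sum.inr i => opD K i

/-- Multiplication by `xᵢ` is exact on normally ordered monomials; for `∂ᵢ` the commutator term has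
smaller degree, hence smaller key. -/
theorem weylGenerator_smul_monomialAt (e : Fin m → E) (k : Fin n ⊕ Fin n)
    (w : MonomialIndex n m) : ∃ l ∈ lowerSpan (K := K) e (shiftIndex w (Pi.single k 1)),
      weylGenerator (K := K) k • monomialAt (K := K) e w =
        monomialAt (K := K) e (shiftIndex w (Pi.single k 1)) + l := by
  rcases k with i | i
  · refine ⟨0, zero_mem _, ?_⟩
    rw [add_zero, monomialAt, ← mul_smul]
    exact congrArg (· • e w.1) (opX_mul_weylMonomial K w.2 i)
  · refine ⟨(w.2 (Sum.inl i) : K) •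
      monomialAt (K := K) e (w.1, w.2 - Pi.single (Sum.inl i) 1), ?_, ?_⟩
    · refine Submodule.smul_mem _ _ (Submodule.subset_span ⟨_, orderKey_lt_of_deg_lt ?_, rfl⟩)
      have h1 : deg (w.2 - Pi.single (Sum.inl i) 1) ≤ deg w.2 := deg_mono tsub_le_self
      have h2 : deg (shiftIndex w (Pi.single (Sum.inr i) 1)).2 = deg w.2 + 1 := by
        rw [shiftIndex, deg_add, deg_single]
      rw [h2]
      exact Nat.lt_succ_of_le h1
    · rw [monomialAt, ← mul_smul]
      refine (congrArg (· • e w.1) (opD_mul_weylMonomial K w.2 i)).trans ?_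
      simp only [add_smul, smul_assoc]
      rfl

theorem smul_smul_comm_weyl (a : K) (D : weylAlgebra K n) (x : E) :
    D • a • x = a • D • x := by
  rw [← algebraMap_smul (weylAlgebra K n) a x, ← algebraMap_smul (weylAlgebra K n) a (D • x),
    ← mul_smul, ← mul_smul, Algebra.commutes]

theorem weylGenerator_smul_mem_lowerSpan (e : Fin m → E) (k : Fin n ⊕ Fin n)
    (w : MonomialIndex n m) {x : E} (hx : x ∈ lowerSpan (K := K) e w) :
    weylGenerator (K := K) k • x ∈ lowerSpan (K := K) e (shiftIndex w (Pi.single k 1)) := by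
  induction hx using Submodule.span_induction with
  | mem x hx =>
    obtain ⟨v, hv, rfl⟩ := hx
    obtain ⟨l, hl, h⟩ := weylGenerator_smul_monomialAt (K := K) e k v
    have hlt := orderKey_shift_lt hv (Pi.single k 1)
    rw [h]
    exact add_mem (Submodule.subset_span ⟨_, hlt, rfl⟩)
      (Submodule.span_mono (Set.image_mono fun _ hz => lt_trans hz hlt) hl)
  | zero => rw [smul_zero]; exact zero_mem _
  | add x y _ _ hx hy => rw [smul_add]; exact add_mem hx hy
  | smul a x _ hx => rw [smul_smul_comm_weyl]; exact Submodule.smul_mem _ _ hx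

theorem IsLeadingMonomial.weylGenerator_smul {e : Module.Basis (Fin m) (weylAlgebra K n) E}
    {g : E} {w : MonomialIndex n m} (h : IsLeadingMonomial e g w) (k : Fin n ⊕ Fin n) :
    IsLeadingMonomial e (weylGenerator (K := K) k • g) (shiftIndex w (Pi.single k 1)) := by
  rw [isLeadingMonomial_iff] at h ⊢
  obtain ⟨a, ha, l, hl, rfl⟩ := h
  obtain ⟨l', hl', h'⟩ := weylGenerator_smul_monomialAt (K := K) e k w
  refine ⟨a, ha, a • l' + weylGenerator (K := K) k • l,
    add_mem (Submodule.smul_mem _ _ hl') (weylGenerator_smul_mem_lowerSpan e k w hl), ?_⟩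
  rw [smul_add, smul_smul_comm_weyl, h', smul_add, add_assoc]

/-- Multiply an element of `N` by one generator at a time: each step moves the leading exponent by a
unit vector. -/
theorem add_mem_submoduleLeadingExponents {e : Module.Basis (Fin m) (weylAlgebra K n) E}
    {N : Submodule (weylAlgebra K n) E} {i : Fin m} {u : Exponent n}
    (hu : u ∈ submoduleLeadingExponents e N i) (v : Exponent n) :
    u + v ∈ submoduleLeadingExponents e N i := by
  obtain ⟨d, hd⟩ : ∃ d, deg v = d := ⟨_, rfl⟩
  induction d generalizing u v with
  | zero =>
    have : v = 0 := by
      ext k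
      exact (Finset.sum_eq_zero_iff.1 hd) k (Finset.mem_univ k)
    rwa [this, add_zero]
  | succ d ih =>
    obtain ⟨k, hk⟩ : ∃ k, v k ≠ 0 := by
      by_contra! hcon
      simp [deg, hcon] at hd
    have hle : Pi.single k 1 ≤ v := by
      intro j
      by_cases hj : j = k
      · subst hj; simp; omega
      · simp [hj]
    have hv := add_tsub_cancel_of_le hle
    have hdeg := congrArg deg hv
    rw [deg_add, deg_single] at hdeg
    rw [← hv, ← add_assoc]
    refine ih ?_ _ (by omega)
    obtain ⟨g, hg, hlead⟩ := hu
    exact ⟨_, N.smul_mem _ hg, hlead.weylGenerator_smul k⟩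

/-- The leading exponents of `G` are among those of `N`, and each one of `N` lies above one of `G`,
so both sets generate the same upper set. -/
theorem notAbove_leadingExponents [CharZero K] {e : Module.Basis (Fin m) (weylAlgebra K n) E}
    {N : Submodule (weylAlgebra K n) E} {G : Finset E} (hG : IsGroebnerBasis e N G)
    (i : Fin m) : notAbove (leadingExponents e G i) =
      notAbove (submoduleLeadingExponents e N i) := by
  ext u
  constructor
  · rintro hu a ⟨h, hN, hlead⟩ hau
    obtain ⟨g, hg, v, w, hv, hw, hdiv⟩ := hG.2 h hN hlead.ne_zero
    obtain rfl := hw.unique hlead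
    obtain ⟨j, v⟩ := v
    obtain ⟨rfl, hle⟩ := hdiv
    exact hu v ⟨g, hg, hv⟩ (hle.trans hau)
  · rintro hu a ⟨g, hg, hlead⟩
    exact hu a ⟨g, (hG.1 g hg).1, hlead⟩

end LeadingMonomial

/-! ### Normal monomials and the dimension of the filtration -/

section Dimension

variable {K : Type*} [Field K] {n m : ℕ}
  {M : Type*} [AddCommGroup M] [Module K M] [Module (weylAlgebra K n) M]
  [IsScalarTower K (weylAlgebra K n) M]
  {E : Type*} [AddCommGroup E] [Module (weylAlgebra K n) E] [Module K E]
  [IsScalarTower K (weylAlgebra K n) E]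

theorem moduleFiltration_eq_span (f : Fin m → M) (r : ℕ) :
    moduleFiltration K (n := n) f r =
      Submodule.span K (monomialAt (K := K) (n := n) f '' {w | deg w.2 ≤ r}) := by
  apply le_antisymm
  · refine iSup_le fun i => ?_
    rw [bernsteinFiltration, Submodule.map_span_le]
    rintro _ ⟨u, hu, rfl⟩
    exact Submodule.subset_span ⟨(i, u), hu, rfl⟩
  · rw [Submodule.span_le]
    rintro _ ⟨w, hw, rfl⟩
    exact Submodule.mem_iSup_of_mem w.1 ⟨_, Submodule.subset_span ⟨w.2, hw, rfl⟩, rfl⟩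

theorem map_linearCombination (π : E →ₗ[weylAlgebra K n] M) (e : Fin m → E) {f : Fin m → M}
    (hπ : ∀ i, π (e i) = f i) (c : MonomialIndex n m →₀ K) :
    π (Finsupp.linearCombination K (monomialAt (K := K) e) c) =
      Finsupp.linearCombination K (monomialAt (K := K) f) c := by
  rw [← sum_smul_smul, ← sum_smul_smul, Finsupp.sum, map_sum]
  exact Finset.sum_congr rfl fun v _ => by rw [map_smul, hπ]

/-- The same coefficients, read in `E`, give an element of `ker π`; if nonzero, its leading monomial
would be normal. -/
theorem linearIndepOn_normalIndices [CharZero K]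
    (e : Module.Basis (Fin m) (weylAlgebra K n) E) (π : E →ₗ[weylAlgebra K n] M)
    {f : Fin m → M} (hπ : ∀ i, π (e i) = f i) (r : ℕ) :
    LinearIndepOn K (monomialAt (K := K) f) (normalIndices e (LinearMap.ker π) r) := by
  rw [linearIndepOn_iff]
  intro c hc h0
  by_contra hne
  obtain ⟨w, hw, hlead⟩ := exists_isLeadingMonomial e hne
  have hmem : w ∈ normalIndices e (LinearMap.ker π) r := hc (Finsupp.mem_support_iff.2 hw)
  refine hmem.1 w.2 ⟨_, ?_, hlead⟩ le_rfl
  rw [LinearMap.mem_ker, map_linearCombination π e hπ, h0]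

theorem map_mem_lowerSpan (e : Fin m → E) (π : E →ₗ[weylAlgebra K n] M)
    {f : Fin m → M} (hπ : ∀ i, π (e i) = f i) {w : MonomialIndex n m} {x : E}
    (hx : x ∈ lowerSpan (K := K) e w) : π x ∈ lowerSpan (K := K) f w := by
  obtain ⟨d, hd, rfl⟩ := (Finsupp.mem_span_image_iff_linearCombination K).1 hx
  rw [map_linearCombination π e hπ]
  exact (Finsupp.mem_span_image_iff_linearCombination K).2 ⟨d, hd, rfl⟩

theorem monomialAt_mem_span_normalIndices
    (e : Module.Basis (Fin m) (weylAlgebra K n) E) (π : E →ₗ[weylAlgebra K n] M)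
    {f : Fin m → M} (hπ : ∀ i, π (e i) = f i) (r : ℕ) (w : MonomialIndex n m)
    (hw : deg w.2 ≤ r) : monomialAt (K := K) f w ∈
      Submodule.span K (monomialAt (K := K) f '' normalIndices e (LinearMap.ker π) r) := by
  revert hw
  refine (InvImage.wf orderKey wellFounded_lt).induction (C := fun w : MonomialIndex n m =>
    deg w.2 ≤ r → monomialAt (K := K) f w ∈
      Submodule.span K (monomialAt (K := K) f '' normalIndices e (LinearMap.ker π) r))
    w fun w ih hw => ?_
  by_cases h : w.2 ∈ notAbove (submoduleLeadingExponents e (LinearMap.ker π) w.1)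
  · exact Submodule.subset_span ⟨w, ⟨h, hw⟩, rfl⟩
  · obtain ⟨u, hu, hle⟩ : ∃ u ∈ submoduleLeadingExponents e (LinearMap.ker π) w.1, u ≤ w.2 := by
      by_contra! hcon
      exact h hcon
    -- By the upper-set property `w` itself is a leading monomial of some `a • w + l` in `ker π`, so
    -- its image is that of `-a⁻¹ • l`, to which induction applies.
    have hlead := add_mem_submoduleLeadingExponents hu (w.2 - u)
    rw [add_tsub_cancel_of_le hle] at hlead
    obtain ⟨g, hg, hgw⟩ := hlead
    obtain ⟨a, ha, l, hl, rfl⟩ := (isLeadingMonomial_iff e g w).1 hgw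
    have hlow : lowerSpan (K := K) f w ≤
        Submodule.span K (monomialAt (K := K) f '' normalIndices e (LinearMap.ker π) r) := by
      refine Submodule.span_le.2 ?_
      rintro _ ⟨v, hv, rfl⟩
      exact ih v hv ((deg_le_of_orderKey_le (le_of_lt hv)).trans hw)
    have hπw : π (monomialAt (K := K) e w) = monomialAt (K := K) f w := by
      rw [monomialAt, map_smul, hπ, monomialAt]
    rw [LinearMap.mem_ker, map_add, LinearMap.map_smul_of_tower, hπw] at hg
    rw [← Submodule.smul_mem_iff _ ha, eq_neg_of_add_eq_zero_left hg]
    exact neg_mem (hlow (map_mem_lowerSpan e π hπ hl))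

theorem moduleFiltration_eq_span_normalIndices
    (e : Module.Basis (Fin m) (weylAlgebra K n) E) (π : E →ₗ[weylAlgebra K n] M)
    {f : Fin m → M} (hπ : ∀ i, π (e i) = f i) (r : ℕ) :
    moduleFiltration K (n := n) f r =
      Submodule.span K (monomialAt (K := K) f '' normalIndices e (LinearMap.ker π) r) := by
  rw [moduleFiltration_eq_span]
  apply le_antisymm
  · rw [Submodule.span_le]
    rintro _ ⟨w, hw, rfl⟩
    exact monomialAt_mem_span_normalIndices e π hπ r w hw
  · exact Submodule.span_mono (Set.image_mono fun w hw => hw.2)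

theorem finrank_moduleFiltration [CharZero K]
    (e : Module.Basis (Fin m) (weylAlgebra K n) E) (π : E →ₗ[weylAlgebra K n] M)
    {f : Fin m → M} (hπ : ∀ i, π (e i) = f i) (r : ℕ) :
    Module.Finite K (moduleFiltration K (n := n) f r) ∧
      Module.finrank K (moduleFiltration K (n := n) f r) =
        ∑ i, (truncate (notAbove (submoduleLeadingExponents e (LinearMap.ker π) i)) r).ncard := by
  have hfin := finite_normalIndices e (LinearMap.ker π) r
  rw [moduleFiltration_eq_span_normalIndices e π hπ, ← ncard_normalIndices]
  refine ⟨Module.Finite.span_of_finite K (hfin.image _), ?_⟩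
  have := hfin.fintype
  rw [Set.image_eq_range]
  refine (finrank_span_eq_card (linearIndepOn_normalIndices e π hπ r)).trans ?_
  rw [← Nat.card_eq_fintype_card, Nat.card_coe_set_eq]

end Dimension

end Bernstein

/-! ### Assembly of the dimension polynomial -/

theorem theorem5p2 {K : Type*} [Field K] [CharZero K] (n m : ℕ)
    {M : Type*} [AddCommGroup M] [Module K M] [Module (Bernstein.weylAlgebra K n) M]
    [IsScalarTower K (Bernstein.weylAlgebra K n) M]
    (f : Fin m → M)
    (hf : Submodule.span (Bernstein.weylAlgebra K n) (Set.range f) = ⊤)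
    {E : Type*} [AddCommGroup E] [Module (Bernstein.weylAlgebra K n) E]
    (e : Module.Basis (Fin m) (Bernstein.weylAlgebra K n) E)
    (π : E →ₗ[Bernstein.weylAlgebra K n] M) (hπ : ∀ i, π (e i) = f i) :
    ∃ χ : Polynomial ℚ, Bernstein.IsNumerical χ ∧
      (∃ r₀ : ℕ, ∀ r : ℕ, r₀ ≤ r →
        Module.Finite K (Bernstein.moduleFiltration K (n := n) f r) ∧
          χ.eval (r : ℚ) =
            (Module.finrank K (Bernstein.moduleFiltration K (n := n) f r) : ℚ)) ∧
      χ.natDegree ≤ 2 * n ∧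
      (∃ a : ℕ → ℤ, χ = ∑ i ∈ Finset.range (2 * n + 1),
        Polynomial.C (a i : ℚ) * Bernstein.binomPoly i) ∧
      ∀ G : Finset E, Bernstein.IsGroebnerBasis e (LinearMap.ker π) G →
        ∃ ω : Fin m → Polynomial ℚ,
          (∀ i, Bernstein.nonMultiples e G i =
              Bernstein.notAbove (Bernstein.leadingExponents e G i) ∧
            Bernstein.IsKolchinPolynomial (Bernstein.leadingExponents e G i) (ω i)) ∧
          χ = ∑ i, ω i := by
  -- `K` acts on `E` through the Weyl algebra. The definition of leading monomials uses only the
  -- action of the Weyl algebra on `E`, so this auxiliary structure does not affect the claim.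
  let _ : Module K E := Module.compHom E (algebraMap K (Bernstein.weylAlgebra K n))
  have _ : IsScalarTower K (Bernstein.weylAlgebra K n) E := ⟨fun a D x => by
    rw [Algebra.smul_def, mul_smul]; rfl⟩
  let N := LinearMap.ker π
  -- The polynomials come from all leading exponents of `N`, so one `χ` serves every Gröbner basis,
  -- and none has to be shown to exist.
  choose a ha using fun i : Fin m =>
    Bernstein.exists_isKolchinPolynomial (Bernstein.submoduleLeadingExponents e N i)
  have hcard : Fintype.card (Fin n ⊕ Fin n) = 2 * n := by simp [two_mul]
  rw [hcard] at ha
  have hsum : ∑ i, ∑ j ∈ Finset.range (2 * n + 1), Polynomial.C (a i j : ℚ) *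
      Bernstein.binomPoly j = ∑ j ∈ Finset.range (2 * n + 1),
        Polynomial.C ((∑ i, a i j : ℤ) : ℚ) * Bernstein.binomPoly j := by
    rw [Finset.sum_comm]
    simp [Finset.sum_mul]
  refine ⟨∑ i, ∑ j ∈ Finset.range (2 * n + 1), Polynomial.C (a i j : ℚ) *
      Bernstein.binomPoly j, ?_, ?_, ?_, ⟨fun j => ∑ i, a i j, hsum⟩, fun G hG => ⟨fun i =>
      ∑ j ∈ Finset.range (2 * n + 1), Polynomial.C (a i j : ℚ) * Bernstein.binomPoly j,
      fun i => ⟨Bernstein.nonMultiples_eq_notAbove e G i, ?_⟩, rfl⟩⟩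
  · rw [hsum]
    exact Bernstein.isNumerical_sum_binomPoly _ _
  · choose s hs using fun i => (ha i).2
    refine ⟨Finset.univ.sup s, fun r hr => ?_⟩
    obtain ⟨hfin, hrank⟩ := Bernstein.finrank_moduleFiltration e π hπ r
    refine ⟨hfin, ?_⟩
    rw [hrank, Polynomial.eval_finsetSum, Nat.cast_sum]
    exact Finset.sum_congr rfl fun i _ =>
      hs i r ((Finset.le_sup (Finset.mem_univ i)).trans hr)
  · refine Polynomial.natDegree_sum_le_of_forall_le _ _ fun i _ =>
      Polynomial.natDegree_sum_le_of_forall_le _ _ fun j hj => ?_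
    exact (Polynomial.natDegree_C_mul_le _ _).trans
      ((Bernstein.natDegree_binomPoly_le j).trans (Nat.lt_succ_iff.1 (Finset.mem_range.1 hj)))
  -- A Kolchin polynomial depends on `A` only through `notAbove A`.
  · rw [Bernstein.IsKolchinPolynomial, Bernstein.notAbove_leadingExponents hG i]
    exact ha i
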